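/- Let $X$ be a real locally convex space with topological dual $X^*$, the latter with a topology compatible with the duality (e.g. weak-$*$). Let $T\neq\emptyset$ be an arbitrary index set, let $f_0:X\to\overline{\mathbb R}=[-\infty,+\infty]$ and $f_t:X\to\overline{\mathbb R}$ $(t\in T)$ be convex functions (i.e. their epigraphs are convex), and put $f:=\sup_{t\in T}f_t$. Consider the problem $$(\mathtt P)\qquad \inf\{f_0(x): f_t(x)\le 0,\ t\in T\},$$ and assume that its optimal value is finite. Notation. $[g\le 0]:=\{x: g(x)\le 0\}$; $\operatorname{dom}g:=\{x:g(x)<+\infty\}$; $g$ is proper if $\operatorname{dom}g\ne\emptyset$ and $g>-\infty$ everywhere; $\bar g$ is the function whose epigraph is the closure of the epigraph of $g$. For $\varepsilon\ge 0$, if $g(x)\in\mathbb R$, $$\partial_\varepsilon g(x):=\{x^*\in X^*:\langle x^*,y-x\rangle\le g(y)-g(x)+\varepsilon\ \text{ for all } y\in X\},$$ and $\partial_\varepsilon g(x):=\emptyset$ otherwise; $\partial g:=\partial_0 g$; and $\mathrm N^\varepsilon_A(x):=\partial_\varepsilon \mathrm I_A(x)$, where $\mathrm I_A$ is $0$ on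 $A$ and $+\infty$ off $A$. For a nonempty closed convex set $A$, $[A]_\infty:=\bigcap_{t>0}t(A-a)$ with $a\in A$ arbitrary (the set does not depend on $a$); $[\emptyset]_\infty:=\{\theta\}$, where $\theta$ is the zero vector. Let $\mathcal P:=\{t\in T:\bar f_t \text{ is proper}\}$, $T_{\varepsilon/s}(x):=\{t\in\mathcal P: s f_t(x)\ge-\varepsilon\}$ for $\varepsilon,s>0$, and $$D_\varepsilon(x):=\overline{\operatorname{co}}\Big(\Big(\bigcup_{s>0,\ t\in T_{\varepsilon/s}(x)}\partial_\varepsilon(sf_t)(x)\Big)\cup\Big(\bigcup_{t\in T\setminus\mathcal P}\mathrm N^\varepsilon_{\operatorname{dom}f_t}(x)\Big)\Big).$$ Theorem. Suppose that either $f_0$ is finite and continuous at some point of $[f\le 0]$, or $\operatorname{int}([f\le 0])\cap\operatorname{dom}f_0\neq\emptyset$, and that $$\overline{[f\le 0]}=\bigcap_{t\in T}[\bar f_t\le 0].$$ Then a feasible point $x$ of $(\mathtt P)$ is optimal if and only if $$\theta\in\partial f_0(x)+[D_\varepsilon(x)]_\infty\quad\text{for every }\varepsilon>0,$$ or, equivalently,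 if and only if $$\theta\in\partial f_0(x)+\bigcap_{\varepsilon>0}D_\varepsilon(x).$$ -/

import Mathlib

open Set Topology
open scoped Pointwise

noncomputable section

namespace InfConvex

section Functions

variable {X : Type*}

/-- The epigraph of an extended-real-valued function, a subset of `X × ℝ`. -/
def epigraph (f : X → EReal) : Set (X × ℝ) := {p | f p.1 ≤ (p.2 : EReal)}

/-- The effective domain. -/
def effDom (f : X → EReal) : Set X := {x | f x < ⊤}

/-- Properness: nonempty domain, and the value `-∞` is never taken. -/
def IsProper (f : X → EReal) : Prop := (effDom f).Nonempty ∧ ∀ x, ⊥ < f x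

/-- The sublevel set `[f ≤ 0]`. -/
def sublevel (f : X → EReal) : Set X := {x | f x ≤ 0}

/-- The indicator function of convex analysis: `0` on `A`, `+∞` off `A`. -/
def ind (A : Set X) (x : X) : EReal := by
  classical exact if x ∈ A then 0 else ⊤

/-- The positive multiple `s f`, used for `s > 0` only. -/
def scale (s : ℝ) (f : X → EReal) (x : X) : EReal := (s : EReal) * f x

/-- The pointwise supremum of a family. -/
def supFun {T : Type*} (f : T → X → EReal) (x : X) : EReal := ⨆ t, f t x

/-- The optimal value of the problem of minimizing `f₀` subject to `f t ≤ 0`, `t ∈ T`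
(the infimum over the empty set being `+∞`). -/
def optValue {T : Type*} (f₀ : X → EReal) (f : T → X → EReal) : EReal :=
  ⨅ x ∈ {x : X | ∀ t, f t x ≤ 0}, f₀ x

/-- `x` is an optimal solution: it is feasible and attains the optimal value. -/
def IsOptimal {T : Type*} (f₀ : X → EReal) (f : T → X → EReal) (x : X) : Prop :=
  (∀ t, f t x ≤ 0) ∧ f₀ x = optValue f₀ f

/-- Convexity of an extended-real-valued function (`±∞` allowed): the epigraph is convex. -/
def ConvexFun [AddCommGroup X] [Module ℝ X] (f : X → EReal) : Prop :=
  Convex ℝ (epigraph f)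

/-- The closed (lower semicontinuous) hull: the function whose epigraph is the closure of the
epigraph of `f`, see `epigraph_closedHull`. -/
def closedHull [TopologicalSpace X] (f : X → EReal) (x : X) : EReal :=
  sInf ((fun r : ℝ => (r : EReal)) '' {r : ℝ | (x, r) ∈ closure (epigraph f)})

theorem closure_epigraph_upward [TopologicalSpace X] (f : X → EReal) {x : X} {r r' : ℝ}
    (h : (x, r) ∈ closure (epigraph f)) (hr : r ≤ r') : (x, r') ∈ closure (epigraph f) := by
  have hc : Continuous (fun p : X × ℝ => (p.1, p.2 + (r' - r))) := by fun_prop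
  have hm : MapsTo (fun p : X × ℝ => (p.1, p.2 + (r' - r))) (epigraph f) (epigraph f) := by
    intro p hp
    have h1 : f p.1 ≤ (p.2 : EReal) := hp
    have h2 : ((p.2 : ℝ) : EReal) ≤ ((p.2 + (r' - r) : ℝ) : EReal) :=
      EReal.coe_le_coe_iff.2 (by linarith)
    exact h1.trans h2
  have := hm.closure hc h
  simpa using this

theorem epigraph_closedHull [TopologicalSpace X] (f : X → EReal) :
    epigraph (closedHull f) = closure (epigraph f) := by
  ext ⟨x, r⟩
  constructor
  · intro h
    have h' : closedHull f x ≤ (r : EReal) := h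
    have key : ∀ r' : ℝ, r < r' → (x, r') ∈ closure (epigraph f) := by
      intro r' hr'
      have hlt : closedHull f x < (r' : EReal) := h'.trans_lt (EReal.coe_lt_coe_iff.2 hr')
      obtain ⟨_, ⟨q, hq, rfl⟩, hq'⟩ := sInf_lt_iff.1 hlt
      exact closure_epigraph_upward f hq (EReal.coe_lt_coe_iff.1 hq').le
    have hcl : IsClosed {r' : ℝ | (x, r') ∈ closure (epigraph f)} :=
      isClosed_closure.preimage (by fun_prop : Continuous (fun r' : ℝ => (x, r')))
    have hsub : Ioi r ⊆ {r' : ℝ | (x, r') ∈ closure (epigraph f)} := fun r' hr' => key r' hr'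
    have := hcl.closure_subset_iff.2 hsub
    rw [closure_Ioi] at this
    exact this (mem_Ici.2 le_rfl)
  · intro h
    have h1 : closedHull f x ≤ (r : EReal) := sInf_le (mem_image_of_mem _ h)
    exact h1

end Functions

section Recession

variable {E : Type*} [AddCommGroup E] [Module ℝ E]

/-- The recession cone `[A]_∞ = ⋂_{t > 0} t (A - a)` of a closed convex set `A`, where `a ∈ A` is
arbitrary (the intersection does not depend on it, see `recessionCone_eq`), with the convention
`[∅]_∞ = {0}`. -/
def recessionCone (A : Set E) : Set E :=
  {d | (A = ∅ → d = 0) ∧ ∀ a ∈ A, ∀ t : ℝ, 0 < t → d ∈ t • (A - {a})}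

theorem mem_smul_sub_singleton {A : Set E} {a d : E} {t : ℝ} (ht : 0 < t) :
    d ∈ t • (A - {a}) ↔ a + t⁻¹ • d ∈ A := by
  rw [mem_smul_set_iff_inv_smul_mem₀ ht.ne', sub_singleton, mem_image]
  constructor
  · rintro ⟨b, hb, h⟩
    rw [← h]
    simpa using hb
  · intro h
    exact ⟨_, h, by simp⟩

theorem recessionCone_eq [TopologicalSpace E] [IsTopologicalAddGroup E] [ContinuousSMul ℝ E]
    {A : Set E} (hc : IsClosed A) (hA : Convex ℝ A) {a : E} (ha : a ∈ A) :
    recessionCone A = ⋂ t : {t : ℝ // 0 < t}, (t : ℝ) • (A - {a}) := by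
  ext d
  simp only [mem_iInter, Subtype.forall]
  constructor
  · intro h t ht
    exact h.2 a ha t ht
  · intro h
    refine ⟨fun h0 => absurd ha (by simp [h0]), fun b hb t ht => ?_⟩
    rw [mem_smul_sub_singleton ht]
    have h1 : ∀ s ∈ Ioo (0 : ℝ) 1, (1 - s) • b + s • (a + (s⁻¹ * t⁻¹) • d) ∈ A := by
      intro s hs
      refine hA hb ?_ (by linarith [hs.2]) hs.1.le (by ring)
      have h2 := h (s * t) (mul_pos hs.1 ht)
      rwa [mem_smul_sub_singleton (mul_pos hs.1 ht), mul_inv] at h2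
    have h3 : ∀ s ∈ Ioo (0 : ℝ) 1, (1 - s) • b + s • a + t⁻¹ • d ∈ A := by
      intro s hs
      have h4 := h1 s hs
      rwa [smul_add, smul_smul, ← mul_assoc, mul_inv_cancel₀ hs.1.ne', one_mul, ← add_assoc] at h4
    have hcont : Continuous (fun s : ℝ => (1 - s) • b + s • a + t⁻¹ • d) := by fun_prop
    have h5 : Ioo (0 : ℝ) 1 ⊆ (fun s : ℝ => (1 - s) • b + s • a + t⁻¹ • d) ⁻¹' A := h3
    have h6 := (hc.preimage hcont).closure_subset_iff.2 h5
    rw [closure_Ioo (by norm_num)] at h6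
    have h7 := h6 (left_mem_Icc.2 (by norm_num : (0 : ℝ) ≤ 1))
    simpa using h7

end Recession

section Duality

variable {X : Type*} [AddCommGroup X] [Module ℝ X] [TopologicalSpace X]

/-- The `ε`-subdifferential of `f` at `x`, a subset of the dual `X*` with its weak-* topology;
it is empty unless `f x` is finite. The exact subdifferential is `epsSubdiff 0 f x`. -/
def epsSubdiff (ε : ℝ) (f : X → EReal) (x : X) : Set (WeakDual ℝ X) :=
  {φ | f x ≠ ⊥ ∧ f x ≠ ⊤ ∧ ∀ y, ((φ (y - x) : ℝ) : EReal) ≤ f y - f x + (ε : EReal)}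

/-- The `ε`-normal set to `A` at `x`. -/
def epsNormal (ε : ℝ) (A : Set X) (x : X) : Set (WeakDual ℝ X) := epsSubdiff ε (ind A) x

variable {T : Type*}

/-- The indices `t` for which the closed hull of `f t` is proper. -/
def properIdx (f : T → X → EReal) : Set T := {t | IsProper (closedHull (f t))}

/-- The index set `T_{ε/s}(x)`: those `t` with proper closed hull and `s f_t(x) ≥ -ε`. -/
def activeIdx (f : T → X → EReal) (ε s : ℝ) (x : X) : Set T :=
  {t | t ∈ properIdx f ∧ ((-ε : ℝ) : EReal) ≤ (s : EReal) * f t x}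

/-- The weak-* closed convex hull of the union of the sets `∂_ε (s f_t)(x)`, over `s > 0` and
`t ∈ T_{ε/s}(x)`, and of the `ε`-normal sets to `dom f_t` at `x`, over the `t` whose closed hull
is not proper. -/
def hullSet (f : T → X → EReal) (ε : ℝ) (x : X) : Set (WeakDual ℝ X) :=
  closure (convexHull ℝ
    ((⋃ s : {s : ℝ // 0 < s}, ⋃ t ∈ activeIdx f ε s x, epsSubdiff ε (scale s (f t)) x) ∪
      ⋃ t ∈ (properIdx f)ᶜ, epsNormal ε (effDom (f t)) x))

end Duality

end InfConvex

end

namespace InfConvex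

/-! ### Closed hulls and continuous affine minorants -/

section Minorants

variable {X : Type*}

/-! Let C = [f ≤ 0], with normal cone N at x. By Hahn–Banach, the qualification makes optimality of
x equivalent to 0 ∈ ∂f₀(x) + N (`exists_subgradient_of_isMinOn`, `isOptimal_of_zero_mem_add`). So it
suffices that N is the recession cone of each D_ε(x), and also the intersection of all D_ε(x).

Elements of D_ε(x) are 2ε-normals to C: one ε comes from the subdifferential, the other from s
f_t(x) ≥ -ε. Passing to recession directions, or letting ε → 0, leaves only normals.

Conversely, as N is a cone and 0 ∈ D_ε(x), the inclusion N ⊆ D_ε(x) is enough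
(`mem_hullSet_of_normal`). If φ ∈ N lies outside, some y separates: ψ(y) < α < φ(y) on D_ε(x). Put z
= x + (ε/α)y. Then φ(z - x) > 0, so z lies outside the closure of C, and the closure hypothesis
gives t with closed hull of f_t positive at z. An affine minorant positive at z (proper case), or a
functional separating z from dom f_t (improper case), rescales to an element of D_ε(x) with value at
least α at y, a contradiction. -/

theorem mem_sublevel_supFun {T : Type*} {f : T → X → EReal} {x : X} :
    x ∈ sublevel (supFun f) ↔ ∀ t, f t x ≤ 0 := by
  simp [sublevel, supFun, iSup_le_iff]

theorem exists_le_coe_of_lt_top {a : EReal} (h : a < ⊤) : ∃ r : ℝ, a ≤ r := by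
  obtain ⟨r, hr, -⟩ := EReal.lt_iff_exists_real_btwn.1 h
  exact ⟨r, hr.le⟩

theorem le_of_forall_coe_ge {a b : EReal} (h : ∀ r : ℝ, b ≤ r → a ≤ r) : a ≤ b :=
  EReal.le_of_forall_lt_iff_le.1 fun r hr => h r hr.le

theorem closedHull_le [TopologicalSpace X] (f : X → EReal) (x : X) : closedHull f x ≤ f x := by
  refine le_of_forall_coe_ge fun r hr => ?_
  have h : (x, r) ∈ epigraph (closedHull f) := by
    rw [epigraph_closedHull]
    exact subset_closure hr
  exact h

theorem isClosed_epigraph_closedHull [TopologicalSpace X] (f : X → EReal) :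
    IsClosed (epigraph (closedHull f)) := by
  rw [epigraph_closedHull]
  exact isClosed_closure

theorem exists_coe_eq_of_mem_properIdx [TopologicalSpace X] {T : Type*} {f : T → X → EReal}
    {t : T} (ht : t ∈ properIdx f) {x : X} (hx : f t x ≤ 0) :
    ∃ a : ℝ, a ≤ 0 ∧ f t x = a := by
  have h1 : f t x ≠ ⊥ := ((ht.2 x).trans_le (closedHull_le _ x)).ne'
  have h2 : f t x ≠ ⊤ := (hx.trans_lt EReal.zero_lt_top).ne
  have h3 := EReal.coe_toReal h2 h1
  refine ⟨_, ?_, h3.symm⟩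
  rw [← h3] at hx
  exact_mod_cast hx

variable [AddCommGroup X] [Module ℝ X]

theorem ConvexFun.convex_sublevel {f : X → EReal} (hf : ConvexFun f) :
    Convex ℝ (sublevel f) := by
  intro u hu w hw a b ha hb hab
  have h := hf (show (u, (0 : ℝ)) ∈ epigraph f from by simpa [epigraph, sublevel] using hu)
    (show (w, (0 : ℝ)) ∈ epigraph f from by simpa [epigraph, sublevel] using hw) ha hb hab
  simpa [epigraph, sublevel] using h

theorem convex_sublevel_supFun {T : Type*} {f : T → X → EReal} (hf : ∀ t, ConvexFun (f t)) :
    Convex ℝ (sublevel (supFun f)) := by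
  have h : sublevel (supFun f) = ⋂ t, sublevel (f t) := by
    ext u
    simp only [mem_sublevel_supFun, mem_iInter]
    rfl
  rw [h]
  exact convex_iInter fun t => (hf t).convex_sublevel

/-- A linear expression bounded above along an upward ray has nonpositive slope. -/
theorem nonpos_of_forall_ge_le {a b c ρ : ℝ} (h : ∀ r, ρ ≤ r → a + b * r ≤ c) : b ≤ 0 := by
  by_contra! hb
  have h1 := h (max ρ ((c - a) / b + 1)) (le_max_left _ _)
  have h2 : b * ((c - a) / b + 1) ≤ b * max ρ ((c - a) / b + 1) :=
    mul_le_mul_of_nonneg_left (le_max_right _ _) hb.le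
  have h3 : b * ((c - a) / b + 1) = c - a + b := by field_simp
  linarith

variable [TopologicalSpace X]

theorem apply_prod (Φ : StrongDual ℝ (X × ℝ)) (u : X) (r : ℝ) :
    Φ (u, r) = (Φ.comp (ContinuousLinearMap.inl ℝ X ℝ)) u + Φ (0, 1) * r := by
  have h : (u, r) = (u, (0 : ℝ)) + r • ((0 : X), (1 : ℝ)) := by simp
  rw [h, map_add, map_smul]
  simp [mul_comm]

/-- A non-vertical hyperplane above which the epigraph lies is, after division by `-β`, the graph of
an affine minorant. -/
theorem le_of_separating {g : X → EReal} {χ : StrongDual ℝ X} {β γ : ℝ} (hβ : β < 0)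
    (h : ∀ u (ρ : ℝ), g u ≤ ρ → χ u + β * ρ ≤ γ) (u : X) :
    ((((-β)⁻¹ • χ) u - (-β)⁻¹ * γ : ℝ) : EReal) ≤ g u := by
  refine le_of_forall_coe_ge fun ρ hρ => EReal.coe_le_coe_iff.2 ?_
  have h1 := h u ρ hρ
  have h2 : (-β)⁻¹ * (χ u - γ) ≤ ρ := by
    rw [inv_mul_le_iff₀ (by linarith)]
    linarith
  simpa [mul_sub] using h2

variable [IsTopologicalAddGroup X] [ContinuousSMul ℝ X]

theorem ConvexFun.closedHull {f : X → EReal} (hf : ConvexFun f) :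
    ConvexFun (closedHull f) := by
  unfold ConvexFun
  rw [epigraph_closedHull]
  exact Convex.closure hf

/-- If the closed hull of `f` takes the value `-∞`, it is nonpositive on the closure of the
domain of `f`. -/
theorem ConvexFun.closedHull_le_zero_of_mem_closure_effDom {f : X → EReal} (hf : ConvexFun f)
    {y : X} (hy : InfConvex.closedHull f y = ⊥) {u : X} (hu : u ∈ closure (effDom f)) :
    InfConvex.closedHull f u ≤ 0 := by
  have hcl := isClosed_epigraph_closedHull f
  have hdom : ∀ w ∈ effDom f, (w, (0 : ℝ)) ∈ epigraph (InfConvex.closedHull f) := by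
    intro w hw
    obtain ⟨ρ, hρ⟩ := exists_le_coe_of_lt_top hw
    -- Over `y` every height is available; the one chosen brings the convex combination with `(w,
    -- ρ)` to height 0. Then s → 0.
    have h1 : Ioo (0 : ℝ) 1 ⊆ (fun s : ℝ => ((1 - s) • w + s • y, (0 : ℝ))) ⁻¹'
        epigraph (InfConvex.closedHull f) := by
      intro s hs
      have h := hf.closedHull
        (show (w, ρ) ∈ epigraph (InfConvex.closedHull f) from (closedHull_le f w).trans hρ)
        (show (y, -((1 - s) * ρ) / s) ∈ epigraph (InfConvex.closedHull f) from by
          simp [epigraph, hy])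
        (by linarith [hs.2] : (0 : ℝ) ≤ 1 - s) hs.1.le (by ring)
      have h0 : (1 - s) * ρ + s * (-((1 - s) * ρ) / s) = 0 := by
        have := hs.1.ne'
        field_simp
        ring
      rw [Prod.smul_mk, Prod.smul_mk, Prod.mk_add_mk, smul_eq_mul, smul_eq_mul, h0] at h
      exact h
    have h2 := (hcl.preimage (by fun_prop :
      Continuous fun s : ℝ => ((1 - s) • w + s • y, (0 : ℝ)))).closure_subset_iff.2 h1
    rw [closure_Ioo (by norm_num)] at h2
    simpa using h2 (left_mem_Icc.2 (by norm_num : (0 : ℝ) ≤ 1))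
  have h3 := (hcl.preimage (by fun_prop :
    Continuous fun w : X => (w, (0 : ℝ)))).closure_subset_iff.2 hdom hu
  simpa [epigraph] using h3

variable [LocallyConvexSpace ℝ X]

theorem exists_separating_epigraph {g : X → EReal} (hg : ConvexFun g)
    (hcl : IsClosed (epigraph g)) (hdom : (effDom g).Nonempty) {z : X} {r : ℝ}
    (hz : (r : EReal) < g z) :
    ∃ (χ : StrongDual ℝ X) (β γ : ℝ), β ≤ 0 ∧ (∀ u (ρ : ℝ), g u ≤ ρ → χ u + β * ρ < γ) ∧
      γ < χ z + β * r := by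
  obtain ⟨Φ, γ, h1, h2⟩ := geometric_hahn_banach_closed_point hg hcl
    (show (z, r) ∉ epigraph g from not_le.2 hz)
  refine ⟨Φ.comp (ContinuousLinearMap.inl ℝ X ℝ), Φ (0, 1), γ, ?_, ?_, ?_⟩
  · obtain ⟨u, hu⟩ := hdom
    obtain ⟨ρ, hρ⟩ := exists_le_coe_of_lt_top hu
    refine nonpos_of_forall_ge_le (ρ := ρ) (c := γ)
      (a := (Φ.comp (ContinuousLinearMap.inl ℝ X ℝ)) u) fun r hr => ?_
    rw [← apply_prod]
    exact (h1 (u, r) (hρ.trans (EReal.coe_le_coe_iff.2 hr))).le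
  · intro u ρ h
    rw [← apply_prod]
    exact h1 (u, ρ) h
  · rwa [← apply_prod]

/-- A closed proper convex function is the supremum of its continuous affine minorants. -/
theorem IsProper.exists_affine_minorant {g : X → EReal} (hp : IsProper g) (hg : ConvexFun g)
    (hcl : IsClosed (epigraph g)) {z : X} {r : ℝ} (hz : (r : EReal) < g z) :
    ∃ (χ : StrongDual ℝ X) (c : ℝ), (∀ u, ((χ u - c : ℝ) : EReal) ≤ g u) ∧ r < χ z - c := by
  obtain ⟨χ, β, γ, hβ, h1, h2⟩ := exists_separating_epigraph hg hcl hp.1 hz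
  rcases hβ.lt_or_eq with hβ | rfl
  · refine ⟨(-β)⁻¹ • χ, (-β)⁻¹ * γ, le_of_separating hβ fun u ρ h => (h1 u ρ h).le, ?_⟩
    have h3 : r < (-β)⁻¹ * (χ z - γ) := by
      rw [lt_inv_mul_iff₀ (by linarith)]
      linarith
    simpa [mul_sub] using h3
  -- Vertical hyperplane: `χ - γ` is negative on the domain and positive at `z`. A non-vertical
  -- minorant, obtained just below a finite value of `g`, stays a minorant when a large multiple of
  -- `χ - γ` is added.
  · obtain ⟨x₁, hx₁⟩ := hp.1
    obtain ⟨a, ha⟩ : ∃ a : ℝ, g x₁ = a :=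
      ⟨_, (EReal.coe_toReal hx₁.ne (hp.2 x₁).ne').symm⟩
    obtain ⟨χ₀, β₀, γ₀, hβ₀, h3, h4⟩ := exists_separating_epigraph hg hcl hp.1
      (show ((a - 1 : ℝ) : EReal) < g x₁ by rw [ha, EReal.coe_lt_coe_iff]; linarith)
    have hβ₀' : β₀ < 0 := by
      have := h3 x₁ a ha.le
      nlinarith
    have h5 := le_of_separating hβ₀' fun u ρ h => (h3 u ρ h).le
    set ψ := (-β₀)⁻¹ • χ₀
    set d := (-β₀)⁻¹ * γ₀
    have hpos : 0 < χ z - γ := by linarith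
    obtain ⟨k, hk0, hk⟩ : ∃ k : ℝ, 0 ≤ k ∧ r - (ψ z - d) < k * (χ z - γ) := by
      refine ⟨max 0 ((r - (ψ z - d)) / (χ z - γ) + 1), le_max_left _ _, ?_⟩
      rw [← div_lt_iff₀ hpos]
      exact (lt_add_one _).trans_le (le_max_right _ _)
    refine ⟨ψ + k • χ, d + k * γ, fun u => ?_, ?_⟩
    · refine le_of_forall_coe_ge fun ρ hρ => EReal.coe_le_coe_iff.2 ?_
      have h6 := EReal.coe_le_coe_iff.1 ((h5 u).trans hρ)
      have h7 := h1 u ρ hρ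
      have h8 : k * (χ u - γ) ≤ 0 := mul_nonpos_of_nonneg_of_nonpos hk0 (by linarith)
      simp only [add_apply, smul_apply, smul_eq_mul] at h6 ⊢
      linarith
    · simp only [add_apply, smul_apply, smul_eq_mul] at hk ⊢
      linarith

end Minorants

/-! ### ε-subgradients and the sets D_ε(x) -/

section Subdifferentials

variable {X : Type*} [AddCommGroup X] [Module ℝ X] [TopologicalSpace X]

/-- Testing against real upper bounds `ρ` avoids extended-real subtraction; a value -∞ is ruled out
because `ρ` could be arbitrarily low. -/
theorem mem_epsSubdiff_iff {ε a : ℝ} {g : X → EReal} {x : X} (ha : g x = a)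
    {φ : WeakDual ℝ X} :
    φ ∈ epsSubdiff ε g x ↔ ∀ y (ρ : ℝ), g y ≤ ρ → φ (y - x) ≤ ρ - a + ε := by
  constructor
  · rintro ⟨-, -, h⟩ y ρ hρ
    have h1 := (h y).trans (add_le_add_left (EReal.sub_le_sub hρ le_rfl) (ε : EReal))
    rw [ha] at h1
    exact_mod_cast h1
  · intro h
    refine ⟨by simp [ha], by simp [ha], fun y => ?_⟩
    rw [ha]
    induction hy : g y with
    | bot =>
      have h1 := h y (φ (y - x) + a - ε - 1) (by simp [hy])
      linarith
    | coe ρ => exact_mod_cast h y ρ hy.le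
    | top => simp

theorem exists_coe_eq_of_mem_epsSubdiff {ε : ℝ} {g : X → EReal} {x : X} {φ : WeakDual ℝ X}
    (h : φ ∈ epsSubdiff ε g x) : ∃ a : ℝ, g x = a :=
  ⟨_, (EReal.coe_toReal h.2.1 h.1).symm⟩

variable {T : Type*} {f : T → X → EReal}

/-- `a + c - χ x` is the gap at `x` between `f t` and its minorant; a scaled gap of at most `ε`
makes `s • χ` an `ε`-subgradient. -/
theorem smul_mem_hullSet_of_minorant {t : T} (ht : t ∈ properIdx f) {x : X} {a : ℝ}
    (ha : f t x = a) {χ : StrongDual ℝ X} {c : ℝ} (hχ : ∀ u, ((χ u - c : ℝ) : EReal) ≤ f t u)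
    {ε s : ℝ} (hs : 0 < s) (h1 : s * (a + c - χ x) ≤ ε) (h2 : -ε ≤ s * a) :
    s • χ.toWeakDual ∈ hullSet f ε x := by
  refine subset_closure (subset_convexHull ℝ _ (Or.inl ?_))
  simp only [mem_iUnion]
  refine ⟨⟨s, hs⟩, t, ⟨ht, ?_⟩, ?_⟩
  · rw [ha]
    exact_mod_cast h2
  · have hx : scale s (f t) x = ((s * a : ℝ) : EReal) := by simp [scale, ha]
    rw [mem_epsSubdiff_iff hx]
    intro y ρ hρ
    have h3 : ((s * (χ y - c) : ℝ) : EReal) ≤ ρ := by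
      rw [EReal.coe_mul]
      exact (mul_le_mul_of_nonneg_left (hχ y) (by exact_mod_cast hs.le)).trans hρ
    have h4 := EReal.coe_le_coe_iff.1 h3
    change s * χ (y - x) ≤ _
    rw [map_sub]
    nlinarith

theorem smul_mem_hullSet_of_le {t : T} (ht : t ∉ properIdx f) {x : X} (hx : x ∈ effDom (f t))
    {χ : StrongDual ℝ X} {c : ℝ} (hχ : ∀ u ∈ effDom (f t), χ u ≤ c)
    {ε s : ℝ} (hs : 0 < s) (h1 : s * (c - χ x) ≤ ε) :
    s • χ.toWeakDual ∈ hullSet f ε x := by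
  refine subset_closure (subset_convexHull ℝ _ (Or.inr ?_))
  simp only [mem_iUnion]
  refine ⟨t, ht, ?_⟩
  have hx0 : ind (effDom (f t)) x = ((0 : ℝ) : EReal) := by simp [ind, hx]
  rw [epsNormal, mem_epsSubdiff_iff hx0]
  intro y ρ hρ
  by_cases hy : y ∈ effDom (f t)
  · have h2 : 0 ≤ ρ := by
      have : ((0 : ℝ) : EReal) ≤ ρ := by simpa [ind, hy] using hρ
      exact EReal.coe_le_coe_iff.1 this
    have h3 := mul_le_mul_of_nonneg_left (hχ y hy) hs.le
    change s * χ (y - x) ≤ _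
    rw [map_sub]
    linarith
  · simp [ind, hy] at hρ

theorem convex_setOf_apply_le (y : X) (c : ℝ) : Convex ℝ {ψ : WeakDual ℝ X | ψ y ≤ c} := by
  intro φ hφ ψ hψ a b ha hb hab
  have h1 : φ y ≤ c := hφ
  have h2 : ψ y ≤ c := hψ
  change a * φ y + b * ψ y ≤ c
  have h3 : c = a * c + b * c := by rw [← add_mul, hab, one_mul]
  rw [h3]
  gcongr

theorem isClosed_setOf_apply_le (y : X) (c : ℝ) : IsClosed {ψ : WeakDual ℝ X | ψ y ≤ c} :=
  isClosed_le (WeakDual.eval_continuous y) continuous_const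

/-- The set `D_ε(x)` consists of `2ε`-normals to the feasible set at `x`. -/
theorem apply_sub_le_of_mem_hullSet {ε : ℝ} (hε : 0 < ε) {x : X} (hx : ∀ t, f t x ≤ 0)
    {ψ : WeakDual ℝ X} (hψ : ψ ∈ hullSet f ε x) {y : X} (hy : ∀ t, f t y ≤ 0) :
    ψ (y - x) ≤ 2 * ε := by
  refine closure_minimal (convexHull_min ?_ (convex_setOf_apply_le (y - x) (2 * ε)))
    (isClosed_setOf_apply_le (y - x) (2 * ε)) hψ
  rintro φ (h | h)
  · simp only [mem_iUnion] at h
    obtain ⟨⟨s, hs⟩, t, ⟨ht, hact⟩, h⟩ := h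
    obtain ⟨b, hb⟩ := exists_coe_eq_of_mem_epsSubdiff h
    have h1 := (mem_epsSubdiff_iff hb).1 h y 0
      (by
        rw [EReal.coe_zero]
        exact mul_nonpos_of_nonneg_of_nonpos (by exact_mod_cast hs.le) (hy t))
    have h2 : -ε ≤ b := by
      have : ((-ε : ℝ) : EReal) ≤ scale s (f t) x := hact
      rw [hb] at this
      exact EReal.coe_le_coe_iff.1 this
    change φ (y - x) ≤ _
    linarith
  · simp only [mem_iUnion] at h
    obtain ⟨t, ht, h⟩ := h
    have hmem : ∀ u, f t u ≤ 0 → ind (effDom (f t)) u = ((0 : ℝ) : EReal) := fun u hu => by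
      simp [ind, effDom, hu.trans_lt EReal.zero_lt_top]
    have h1 := (mem_epsSubdiff_iff (hmem x (hx t))).1 h y 0 (hmem y (hy t)).le
    change φ (y - x) ≤ _
    linarith

/-- Recession directions of `D_ε(x)` are normal to the feasible set at `x`. -/
theorem apply_sub_nonpos_of_mem_recessionCone {ε : ℝ} (hε : 0 < ε) {x : X}
    (hx : ∀ t, f t x ≤ 0) {ψ : WeakDual ℝ X} (hψ : ψ ∈ recessionCone (hullSet f ε x)) {y : X}
    (hy : ∀ t, f t y ≤ 0) : ψ (y - x) ≤ 0 := by
  rcases (hullSet f ε x).eq_empty_or_nonempty with h | ⟨a, ha⟩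
  · rw [hψ.1 h]
    exact le_rfl
  · by_contra! hpos
    -- Chosen so that `a + k • ψ` takes the value 2ε + 1 at `y - x`, exceeding the bound on D_ε(x).
    set k := (2 * ε - a (y - x) + 1) / ψ (y - x)
    have hk : 0 < k :=
      div_pos (by linarith [apply_sub_le_of_mem_hullSet hε hx ha hy]) hpos
    have h1 := (mem_smul_sub_singleton (inv_pos.2 hk)).1 (hψ.2 a ha _ (inv_pos.2 hk))
    have h2 := apply_sub_le_of_mem_hullSet hε hx h1 hy
    rw [inv_inv] at h2
    change a (y - x) + k * ψ (y - x) ≤ _ at h2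
    rw [div_mul_cancel₀ _ hpos.ne'] at h2
    linarith

theorem isClosed_hullSet (ε : ℝ) (x : X) : IsClosed (hullSet f ε x) := isClosed_closure

theorem convex_hullSet (ε : ℝ) (x : X) : Convex ℝ (hullSet f ε x) :=
  (convex_convexHull ℝ _).closure

/-- A point outside a weak-* closed convex set is strictly separated from it by an element of the
primal space. -/
theorem exists_separating_eval {D : Set (WeakDual ℝ X)} (hc : Convex ℝ D) (hcl : IsClosed D)
    {φ : WeakDual ℝ X} (hφ : φ ∉ D) : ∃ (y : X) (α : ℝ), (∀ ψ ∈ D, ψ y < α) ∧ α < φ y := by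
  have : LocallyConvexSpace ℝ (WeakDual ℝ X) :=
    inferInstanceAs (LocallyConvexSpace ℝ (WeakBilin (topDualPairing ℝ X)))
  obtain ⟨F, α, h1, h2⟩ := geometric_hahn_banach_closed_point hc hcl hφ
  obtain ⟨y, hy⟩ := LinearMap.dualEmbedding_surjective (topDualPairing ℝ X) F
  have hF : ∀ ψ : WeakDual ℝ X, F ψ = ψ y := fun ψ => by
    rw [← hy]
    rfl
  exact ⟨y, α, fun ψ hψ => hF ψ ▸ h1 ψ hψ, hF φ ▸ h2⟩

/-- Used with `a` the constraint value at `x` (0 in the improper case), `δ` the gap there and `w = χ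
y`; `hw` then says that the minorant is positive at z. Since `δ` and `-a` are nonnegative, s = ε/(δ
- a) works unless both vanish. -/
theorem exists_pos_scaling {ε α a δ w : ℝ} (hε : 0 < ε) (hα : 0 < α) (hδ : 0 ≤ δ) (ha : a ≤ 0)
    (hw : δ - a < ε / α * w) : ∃ s : ℝ, 0 < s ∧ s * δ ≤ ε ∧ -ε ≤ s * a ∧ α ≤ s * w := by
  rcases (show 0 ≤ δ - a by linarith).eq_or_lt with h | h
  · obtain rfl : δ = 0 := by linarith
    obtain rfl : a = 0 := by linarith
    have hw' : 0 < w := by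
      rw [← h] at hw
      exact (pos_iff_pos_of_mul_pos hw).1 (div_pos hε hα)
    exact ⟨α / w, div_pos hα hw', by simpa using hε.le, by simpa using hε.le,
      (div_mul_cancel₀ _ hw'.ne').ge⟩
  · have hs : 0 < ε / (δ - a) := div_pos hε h
    have hs' : ε / (δ - a) * (δ - a) = ε := div_mul_cancel₀ _ h.ne'
    refine ⟨ε / (δ - a), hs, by nlinarith, by nlinarith, ?_⟩
    have h1 : δ - a < ε * w / α := by rwa [div_mul_eq_mul_div] at hw
    rw [lt_div_iff₀ hα] at h1
    rw [div_mul_eq_mul_div, le_div_iff₀ h]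
    linarith

theorem isOptimal_of_zero_mem_add {f₀ : X → EReal} {x : X} (hx : ∀ t, f t x ≤ 0)
    {N : Set (WeakDual ℝ X)}
    (hN : ∀ ψ ∈ N, ∀ y, (∀ t, f t y ≤ 0) → ψ (y - x) ≤ 0)
    (h : (0 : WeakDual ℝ X) ∈ epsSubdiff 0 f₀ x + N) : IsOptimal f₀ f x := by
  obtain ⟨χ, hχ, ψ, hψ, h0⟩ := h
  obtain ⟨a, ha⟩ := exists_coe_eq_of_mem_epsSubdiff hχ
  refine ⟨hx, le_antisymm (le_iInf₂ fun y hy => ?_) (iInf₂_le x hx)⟩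
  rw [ha]
  refine le_of_forall_coe_ge fun ρ hρ => EReal.coe_le_coe_iff.2 ?_
  have h1 := (mem_epsSubdiff_iff ha).1 hχ y ρ hρ
  have h2 := hN ψ hψ y hy
  have h3 : χ (y - x) + ψ (y - x) = 0 := congrArg (fun θ : WeakDual ℝ X => θ (y - x)) h0
  linarith

/-! ### Subgradient optimality condition under the qualification -/

variable [IsTopologicalAddGroup X] [ContinuousSMul ℝ X]

/-- Optimality condition for minimizing a convex function over a convex set, under the
Moreau–Rockafellar qualification. -/
theorem exists_subgradient_of_isMinOn {g : X → EReal} (hg : ConvexFun g) {C : Set X}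
    (hC : Convex ℝ C) {x : X} (hx : x ∈ C) {v : ℝ} (hv : g x = v)
    (hmin : ∀ u ∈ C, (v : EReal) ≤ g u)
    (hqual : (∃ x₀ ∈ C, x₀ ∈ effDom g ∧ ContinuousAt g x₀) ∨
      (interior C ∩ effDom g).Nonempty) :
    ∃ χ : WeakDual ℝ X, χ ∈ epsSubdiff 0 g x ∧ ∀ u ∈ C, 0 ≤ χ (u - x) := by
  have hsep : ∃ (χ : StrongDual ℝ X) (β γ : ℝ), β < 0 ∧
      (∀ u (ρ : ℝ), g u ≤ ρ → χ u + β * ρ ≤ γ) ∧ ∀ u ∈ C, ∀ ρ < v, γ ≤ χ u + β * ρ := by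
    -- Separate the epigraph from C × (-∞, v). Strict inequality between two points over the same
    -- `x₀` forces the hyperplane to be non-vertical; the qualification supplies them, one being
    -- interior to its set.
    suffices h : ∃ (Φ : StrongDual ℝ (X × ℝ)) (γ : ℝ) (x₀ : X) (r₀ ρ₀ : ℝ),
        (∀ p ∈ epigraph g, Φ p ≤ γ) ∧ (∀ p ∈ C ×ˢ Iio v, γ ≤ Φ p) ∧
        (x₀, r₀) ∈ epigraph g ∧ (x₀, ρ₀) ∈ C ×ˢ Iio v ∧ Φ (x₀, r₀) < Φ (x₀, ρ₀) by
      obtain ⟨Φ, γ, x₀, r₀, ρ₀, h1, h2, h3, h4, h5⟩ := h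
      refine ⟨Φ.comp (ContinuousLinearMap.inl ℝ X ℝ), Φ (0, 1), γ, ?_, ?_, ?_⟩
      · rw [apply_prod Φ x₀ r₀, apply_prod Φ x₀ ρ₀] at h5
        have hr : ρ₀ < r₀ := by
          have h6 : ρ₀ < v := h4.2
          have h7 : (v : EReal) ≤ r₀ := (hmin x₀ h4.1).trans h3
          exact h6.trans_le (EReal.coe_le_coe_iff.1 h7)
        by_contra! hβ
        nlinarith
      · intro u ρ h
        rw [← apply_prod]
        exact h1 _ h
      · intro u hu ρ h
        rw [← apply_prod]
        exact h2 _ ⟨hu, h⟩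
    have hconv : Convex ℝ (C ×ˢ Iio v) := hC.prod (convex_Iio v)
    have hdisj : Disjoint (epigraph g) (C ×ˢ Iio v) := by
      rw [Set.disjoint_left]
      rintro ⟨u, ρ⟩ h1 ⟨h2, h3⟩
      have h4 : (v : EReal) ≤ ρ := (hmin u h2).trans h1
      exact (not_lt.2 (EReal.coe_le_coe_iff.1 h4)) h3
    rcases hqual with ⟨x₀, hx₀, hd, hcont⟩ | ⟨x₀, hx₀, hd⟩
    · obtain ⟨r, hr, -⟩ := EReal.lt_iff_exists_real_btwn.1 hd
      have hint : (x₀, r + 1) ∈ interior (epigraph g) := by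
        rw [mem_interior_iff_mem_nhds]
        filter_upwards [prod_mem_nhds (hcont (Iio_mem_nhds hr))
          (Ioi_mem_nhds (show r < r + 1 by linarith))] with p hp
        exact (le_of_lt hp.1).trans (EReal.coe_le_coe_iff.2 (le_of_lt hp.2))
      obtain ⟨Φ, γ, h1, h2⟩ := geometric_hahn_banach_open hg.interior isOpen_interior hconv
        (hdisj.mono_left interior_subset)
      have hmem : (x₀, v - 1) ∈ C ×ˢ Iio v := ⟨hx₀, by simp⟩
      refine ⟨Φ, γ, x₀, r + 1, v - 1, fun p hp => ?_, h2, interior_subset hint, hmem,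
        (h1 _ hint).trans_le (h2 _ hmem)⟩
      have h3 : p ∈ closure (interior (epigraph g)) := by
        rw [Convex.closure_interior_eq_closure_of_nonempty_interior hg ⟨_, hint⟩]
        exact subset_closure hp
      exact (isClosed_le Φ.continuous continuous_const).closure_subset_iff.2
        (fun q hq => (h1 q hq).le) h3
    · obtain ⟨r, hr, -⟩ := EReal.lt_iff_exists_real_btwn.1 hd
      have hint : (x₀, v - 1) ∈ interior (C ×ˢ Iio v) := by
        rw [interior_prod_eq, interior_Iio]
        exact ⟨hx₀, by simp⟩
      have hmem : (x₀, r) ∈ epigraph g := le_of_lt hr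
      obtain ⟨Φ, γ, h1, h2⟩ := geometric_hahn_banach_open hconv.interior isOpen_interior hg
        (hdisj.mono_right interior_subset).symm
      refine ⟨-Φ, -γ, x₀, r, v - 1, fun p hp => neg_le_neg (h2 p hp), fun p hp => ?_, hmem,
        interior_subset hint, neg_lt_neg ((h1 _ hint).trans_le (h2 _ hmem))⟩
      have h3 : p ∈ closure (interior (C ×ˢ Iio v)) := by
        rw [hconv.closure_interior_eq_closure_of_nonempty_interior ⟨_, hint⟩]
        exact subset_closure hp
      exact neg_le_neg ((isClosed_le Φ.continuous continuous_const).closure_subset_iff.2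
        (fun q hq => (h1 q hq).le) h3)
  obtain ⟨χ, β, γ, hβ, h1, h2⟩ := hsep
  have h3 : ∀ u ∈ C, γ ≤ χ u + β * v := by
    intro u hu
    have h4 : Iio v ⊆ {ρ : ℝ | γ ≤ χ u + β * ρ} := fun ρ hρ => h2 u hu ρ hρ
    have h5 := (isClosed_le continuous_const (by fun_prop) :
      IsClosed {ρ : ℝ | γ ≤ χ u + β * ρ}).closure_subset_iff.2 h4
    rw [closure_Iio] at h5
    exact h5 (mem_Iic.2 le_rfl)
  -- With `h3` at `x` this gives γ = χ x + β v: the hyperplane passes through `(x, v)`.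
  have h6 := h1 x v hv.le
  have hb : 0 < (-β)⁻¹ := inv_pos.2 (by linarith)
  refine ⟨(-β)⁻¹ • χ.toWeakDual, (mem_epsSubdiff_iff hv).2 fun y ρ hρ => ?_, fun u hu => ?_⟩
  · change (-β)⁻¹ * χ (y - x) ≤ _
    rw [inv_mul_le_iff₀ (by linarith), map_sub]
    linarith [h1 y ρ hρ, h3 x hx]
  · change 0 ≤ (-β)⁻¹ * χ (u - x)
    rw [map_sub]
    exact mul_nonneg hb.le (by linarith [h3 u hu])

/-! ### Normals to the feasible set belong to D_ε(x) -/

variable [LocallyConvexSpace ℝ X]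

theorem zero_mem_hullSet [Nonempty T] (hf : ∀ t, ConvexFun (f t)) {x : X}
    (hx : ∀ t, f t x ≤ 0) {ε : ℝ} (hε : 0 < ε) : (0 : WeakDual ℝ X) ∈ hullSet f ε x := by
  obtain ⟨t⟩ := ‹Nonempty T›
  by_cases ht : t ∈ properIdx f
  · obtain ⟨a, ha0, ha⟩ := exists_coe_eq_of_mem_properIdx ht (hx t)
    obtain ⟨r, -, hr⟩ := EReal.lt_iff_exists_real_btwn.1 (ht.2 x)
    obtain ⟨χ, c, hχ, -⟩ := IsProper.exists_affine_minorant ht (hf t).closedHull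
      (isClosed_epigraph_closedHull _) hr
    have hχ' : ∀ u, ((χ u - c : ℝ) : EReal) ≤ f t u := fun u => (hχ u).trans (closedHull_le _ u)
    have hδ : 0 ≤ a + c - χ x := by
      have := hχ' x
      rw [ha, EReal.coe_le_coe_iff] at this
      linarith
    set δ := a + c - χ x
    have hM : 0 < δ - a + 1 := by linarith
    -- Small multiples of the slope of any affine minorant lie in D_ε(x), and 0 is their limit as s
    -- → 0.
    have h1 : Ioo 0 (ε / (δ - a + 1)) ⊆
        (fun s : ℝ => s • χ.toWeakDual) ⁻¹' hullSet f ε x := by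
      intro s hs
      have hs2 := (lt_div_iff₀ hM).1 hs.2
      have hs1 := hs.1
      exact smul_mem_hullSet_of_minorant ht ha hχ' hs1
        (show s * δ ≤ ε by nlinarith) (by nlinarith)
    have h2 := ((isClosed_hullSet ε x).preimage (by fun_prop :
      Continuous fun s : ℝ => s • χ.toWeakDual)).closure_subset_iff.2 h1
    rw [closure_Ioo (div_pos hε hM).ne] at h2
    simpa using h2 (left_mem_Icc.2 (div_pos hε hM).le)
  · have h := smul_mem_hullSet_of_le (ε := ε) (χ := 0) (c := 0) ht
      (show x ∈ effDom (f t) from (hx t).trans_lt EReal.zero_lt_top)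
      (fun u _ => le_rfl) one_pos (by simpa using hε.le)
    simpa using h

/-- The normal cone to the feasible set at `x` is contained in each `D_ε(x)`. -/
theorem mem_hullSet_of_normal [Nonempty T] (hf : ∀ t, ConvexFun (f t))
    (hcl : closure (sublevel (supFun f)) = ⋂ t, sublevel (closedHull (f t)))
    {x : X} (hx : ∀ t, f t x ≤ 0) {φ : WeakDual ℝ X}
    (hφ : ∀ y ∈ sublevel (supFun f), φ (y - x) ≤ 0) {ε : ℝ} (hε : 0 < ε) :
    φ ∈ hullSet f ε x := by
  by_contra hn
  obtain ⟨y, α, h1, h2⟩ := exists_separating_eval (convex_hullSet ε x) (isClosed_hullSet ε x) hn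
  have hα : 0 < α := h1 0 (zero_mem_hullSet hf hx hε)
  have hlam : 0 < ε / α := div_pos hε hα
  have hmem : x + (ε / α) • y ∈ closure (sublevel (supFun f)) := by
    rw [hcl, mem_iInter]
    intro t
    by_contra hpos
    by_cases ht : t ∈ properIdx f
    · obtain ⟨a, ha0, ha⟩ := exists_coe_eq_of_mem_properIdx ht (hx t)
      obtain ⟨χ, c, hχ, hχz⟩ := IsProper.exists_affine_minorant ht (hf t).closedHull
        (isClosed_epigraph_closedHull _)
        (show ((0 : ℝ) : EReal) < closedHull (f t) (x + (ε / α) • y) from not_le.1 hpos)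
      have hχ' : ∀ u, ((χ u - c : ℝ) : EReal) ≤ f t u :=
        fun u => (hχ u).trans (closedHull_le _ u)
      have hδ := hχ' x
      rw [ha, EReal.coe_le_coe_iff] at hδ
      rw [map_add, map_smul, smul_eq_mul] at hχz
      obtain ⟨s, hs, hs1, hs2, hs3⟩ := exists_pos_scaling (δ := a + c - χ x) (w := χ y) hε hα
        (by linarith) ha0 (by linarith)
      exact (h1 _ (smul_mem_hullSet_of_minorant ht ha hχ' hs hs1 hs2)).not_ge hs3
    · have hxd : x ∈ effDom (f t) := (hx t).trans_lt EReal.zero_lt_top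
      -- The domain contains `x`, so improperness means a value -∞; the hull is then nonpositive on
      -- the closure of the domain, which therefore misses z.
      obtain ⟨u, hu⟩ : ∃ u, closedHull (f t) u = ⊥ := by
        by_contra! hne
        exact ht ⟨⟨x, (closedHull_le _ x).trans_lt hxd⟩, fun u => bot_lt_iff_ne_bot.2 (hne u)⟩
      have hd : Convex ℝ (effDom (f t)) := by
        have h3 : effDom (f t) = Prod.fst '' epigraph (f t) := by
          ext w
          constructor
          · intro hw
            obtain ⟨ρ, hρ⟩ := exists_le_coe_of_lt_top hw
            exact ⟨(w, ρ), hρ, rfl⟩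
          · rintro ⟨⟨w, ρ⟩, hρ, rfl⟩
            exact lt_of_le_of_lt hρ (EReal.coe_lt_top ρ)
        rw [h3]
        exact (hf t).linear_image (LinearMap.fst ℝ X ℝ)
      obtain ⟨χ, c, hχ, hχz⟩ := geometric_hahn_banach_closed_point hd.closure isClosed_closure
        (fun hz => hpos ((hf t).closedHull_le_zero_of_mem_closure_effDom hu hz))
      have hχ' : ∀ w ∈ effDom (f t), χ w ≤ c := fun w hw => (hχ w (subset_closure hw)).le
      rw [map_add, map_smul, smul_eq_mul] at hχz
      obtain ⟨s, hs, hs1, -, hs3⟩ := exists_pos_scaling (δ := c - χ x) (a := 0) (w := χ y) hε hα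
        (by linarith [hχ' x hxd]) le_rfl (by linarith)
      exact (h1 _ (smul_mem_hullSet_of_le ht hxd hχ' hs hs1)).not_ge hs3
  have hφz : φ (x + (ε / α) • y - x) ≤ 0 :=
    (isClosed_le (φ.toStrongDual.continuous.comp (continuous_id.sub continuous_const))
      continuous_const).closure_subset_iff.2 hφ hmem
  rw [add_sub_cancel_left, map_smul, smul_eq_mul] at hφz
  nlinarith

theorem mem_recessionCone_hullSet_of_normal [Nonempty T] (hf : ∀ t, ConvexFun (f t))
    (hcl : closure (sublevel (supFun f)) = ⋂ t, sublevel (closedHull (f t)))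
    {x : X} (hx : ∀ t, f t x ≤ 0) {φ : WeakDual ℝ X}
    (hφ : ∀ y ∈ sublevel (supFun f), φ (y - x) ≤ 0) {ε : ℝ} (hε : 0 < ε) :
    φ ∈ recessionCone (hullSet f ε x) := by
  rw [recessionCone_eq (isClosed_hullSet ε x) (convex_hullSet ε x) (zero_mem_hullSet hf hx hε)]
  simp only [mem_iInter, Subtype.forall]
  intro s hs
  rw [mem_smul_sub_singleton hs, zero_add]
  refine mem_hullSet_of_normal hf hcl hx (fun y hy => ?_) hε
  exact mul_nonpos_of_nonneg_of_nonpos (inv_pos.2 hs).le (hφ y hy)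

end Subdifferentials

end InfConvex

theorem mainTheorem4 {X : Type*} [AddCommGroup X] [Module ℝ X] [TopologicalSpace X]
    [IsTopologicalAddGroup X] [ContinuousSMul ℝ X] [LocallyConvexSpace ℝ X]
    {T : Type*} [Nonempty T] (f₀ : X → EReal) (f : T → X → EReal)
    (hf₀ : InfConvex.ConvexFun f₀) (hf : ∀ t, InfConvex.ConvexFun (f t))
    (hval : ∃ v : ℝ, InfConvex.optValue f₀ f = (v : EReal))
    (hqual : (∃ x₀ ∈ InfConvex.sublevel (InfConvex.supFun f),
          x₀ ∈ InfConvex.effDom f₀ ∧ ContinuousAt f₀ x₀) ∨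
        (interior (InfConvex.sublevel (InfConvex.supFun f)) ∩ InfConvex.effDom f₀).Nonempty)
    (hcl : closure (InfConvex.sublevel (InfConvex.supFun f)) =
        ⋂ t, InfConvex.sublevel (InfConvex.closedHull (f t)))
    (x : X) (hx : ∀ t, f t x ≤ 0) :
    (InfConvex.IsOptimal f₀ f x ↔
        ∀ ε : ℝ, 0 < ε → (0 : WeakDual ℝ X) ∈
          InfConvex.epsSubdiff 0 f₀ x + InfConvex.recessionCone (InfConvex.hullSet f ε x)) ∧
      (InfConvex.IsOptimal f₀ f x ↔
        (0 : WeakDual ℝ X) ∈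
          InfConvex.epsSubdiff 0 f₀ x +
            ⋂ ε : {ε : ℝ // 0 < ε}, InfConvex.hullSet f ε x) := by
  have hfwd : InfConvex.IsOptimal f₀ f x → ∃ χ ∈ InfConvex.epsSubdiff 0 f₀ x,
      ∀ y ∈ InfConvex.sublevel (InfConvex.supFun f), (-χ) (y - x) ≤ 0 := by
    rintro ⟨-, hopt⟩
    obtain ⟨v, hv⟩ := hval
    obtain ⟨χ, hχ, h⟩ := InfConvex.exists_subgradient_of_isMinOn hf₀
      (InfConvex.convex_sublevel_supFun hf) (InfConvex.mem_sublevel_supFun.2 hx)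
      (hopt.trans hv)
      (fun u hu => hv ▸ iInf₂_le u (InfConvex.mem_sublevel_supFun.1 hu)) hqual
    exact ⟨χ, hχ, fun y hy => neg_nonpos.2 (h y hy)⟩
  refine ⟨⟨fun h ε hε => ?_, fun h => ?_⟩, fun h => ?_, fun h => ?_⟩
  · obtain ⟨χ, hχ, hn⟩ := hfwd h
    exact ⟨χ, hχ, -χ, InfConvex.mem_recessionCone_hullSet_of_normal hf hcl hx hn hε,
      add_neg_cancel χ⟩
  · exact InfConvex.isOptimal_of_zero_mem_add hx
      (fun ψ hψ y hy => InfConvex.apply_sub_nonpos_of_mem_recessionCone one_pos hx hψ hy)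
      (h 1 one_pos)
  · obtain ⟨χ, hχ, hn⟩ := hfwd h
    exact ⟨χ, hχ, -χ, mem_iInter.2 fun ε =>
      InfConvex.mem_hullSet_of_normal hf hcl hx hn ε.2, add_neg_cancel χ⟩
  · refine InfConvex.isOptimal_of_zero_mem_add hx (fun ψ hψ y hy => ?_) h
    refine le_of_forall_pos_le_add fun ε hε => ?_
    -- Members of D_{ε/2}(x) are `ε`-normals.
    have h1 := InfConvex.apply_sub_le_of_mem_hullSet (half_pos hε) hx
      (mem_iInter.1 hψ ⟨ε / 2, half_pos hε⟩) hy
    linarith
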